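/- Let $\mu,\tau>0$ and $\alpha\in(0,1)$, and let $J_\alpha(t)=\frac1\mu\left[1+(t/\tau)^\alpha+t/\tau\right]$, $t\ge 0$, be the creep compliance of the Andrade model. The relaxation modulus $G_\alpha$ is the continuous function on $(0,\infty)$ whose Laplace transform $\tilde G_\alpha(s)=\int_0^\infty e^{-st}G_\alpha(t)\,dt$ converges absolutely and satisfies $\tilde J_\alpha(s)\,\tilde G_\alpha(s)=1/s^2$ for all $s>0$, i.e. $\tilde G_\alpha(s)=\mu\tau/\left(1+s\tau+\Gamma(1+\alpha)(s\tau)^{1-\alpha}\right)$. Such a function exists, and as $t\to+\infty$ it satisfies $$G_\alpha(t)\sim\mu\,\alpha(1-\alpha)\left(\frac t\tau\right)^{\alpha-2},$$ $$G_\alpha(t)=\mu(1-\alpha)\left[\alpha\left(\frac t\tau\right)^{\alpha-2}-2\,\frac{\Gamma(1+\alpha)^2}{\Gamma(2\alpha-1)}\left(\frac t\tau\right)^{2\alpha-3}\right]+o\!\left(\left(\frac t\tau\right)^{2\alpha-3}\right),$$ and, to every order $N=0,1,2,\dots$, $$G_\alpha(t)=\mu\sum_{k=0}^{N-1}(-1)^k\sum_{l=0}^{k}\binom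 kl\frac{\Gamma(1+\alpha)^l}{\Gamma(l\alpha-k)}\left(\frac t\tau\right)^{l\alpha-k-1}+O\!\left(\left(\frac t\tau\right)^{-N(1-\alpha)-1}\right),$$ where $1/\Gamma$ is taken to be $0$ at the poles $0,-1,-2,\dots$ of $\Gamma$. In particular, for $\alpha=1/3$, $$G_{1/3}(t)\sim\frac29\,\mu\left(\frac t\tau\right)^{-5/3},\qquad t\to+\infty .$$ -/

import Mathlib

open Filter Asymptotics MeasureTheory Set

noncomputable section

/-- The one-sided Laplace transform of a real function at the real point `s`. -/
def laplaceTransform (f : ℝ → ℝ) (s : ℝ) : ℝ :=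
  ∫ t in Ioi (0 : ℝ), Real.exp (-(s * t)) * f t

/-- Creep compliance of the Andrade model,
`J_α(t) = (1/μ) (1 + (t/τ)^α + t/τ)`, for `t ≥ 0`. -/
def andradeCreepCompliance (α μ τ t : ℝ) : ℝ :=
  1 / μ * (1 + (t / τ) ^ α + t / τ)

/-- `G` is the relaxation modulus of the linear viscoelastic material with creep compliance `J`:
`G` is continuous for `t > 0`, its Laplace transform converges absolutely for every `s > 0`, and
the Laplace transforms satisfy `J̃(s) G̃(s) = 1 / s²`. By uniqueness of Laplace transforms of
continuous functions, this determines `G` on `(0, ∞)`; the values for `t ≤ 0` play no role. -/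
structure IsRelaxationModulus (J G : ℝ → ℝ) : Prop where
  continuousOn : ContinuousOn G (Ioi 0)
  integrableOn : ∀ s : ℝ, 0 < s → IntegrableOn (fun t => Real.exp (-(s * t)) * G t) (Ioi 0)
  laplace_mul : ∀ s : ℝ, 0 < s → laplaceTransform J s * laplaceTransform G s = 1 / s ^ 2

/-- Inverse Laplace transform, for `x > 0`, of the power `s ^ d`: the function
`x ^ (-d - 1) / Γ(-d)`, with the usual convention `1 / Γ = 0` at the poles of `Γ`
(in Mathlib `Γ` takes the value `0` at its poles, and `1 / 0 = 0`). -/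
def inverseLaplacePower (d x : ℝ) : ℝ :=
  (Real.Gamma (-d))⁻¹ * x ^ (-d - 1)

/-- Termwise inverse Laplace transform, at `x`, of the sum of the terms of order less than `N` in
the geometric expansion `∑ (-1)^k (s + Γ(1+α) s^(1-α))^k`
of `1 / (1 + s + Γ(1+α) s^(1-α))` as `s → 0⁺`. -/
def andradeLongTimeSum (α : ℝ) (N : ℕ) (x : ℝ) : ℝ :=
  ∑ k ∈ Finset.range N, (-1 : ℝ) ^ k * ∑ l ∈ Finset.range (k + 1),
    (k.choose l : ℝ) * Real.Gamma (1 + α) ^ l * inverseLaplacePower ((k : ℝ) - (l : ℝ) * α) x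

end

/-! Write G(t) = μ g(t/τ). Then g must have Laplace transform F(s) = 1/(1 + s + c s^β), with β = 1 -
α and c = Γ(1+α).

Existence. The denominator 1 + z + c z^β has positive imaginary part in the upper half-plane and on
the upper lip of the cut (-∞, 0], is positive on the positive axis, and is symmetric under
conjugation. So F is analytic off the cut and continuous up to both lips away from 0. Cauchy's
theorem gives F(s) = ∫ K(r)/(r+s) dr over r > 0, where K ≥ 0 comes from the jump of F across the cut
(`integral_spectralDensity_div`). As 1/(r+s) is the Laplace transform of e^{-rt}, Fubini shows that
g(t) = ∫ e^{-rt} K(r) dr has transform F (`laplaceTransform_spectralLaplace`).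

Uniqueness (`eqOn_of_laplaceTransform_eq`) follows from Weierstrass approximation in the variable
e^{-t}, so every relaxation modulus is this explicit one on (0, ∞).

Asymptotics are Watson's lemma. The geometric series for F, taken on the cut, expands K in powers
r^d with remainder at most A(r^N + r^{N(1-α)}) for every r > 0
(`exists_abs_spectralDensity_sub_le`); since the bound is global, no splitting of the integral is
needed. The term in r^d integrates to a multiple of -π⁻¹ sin(πd) Γ(d+1) t^{-d-1}, which is
t^{-d-1}/Γ(-d) by the reflection formula. The cases N = 2 and N = 3 give the two explicit
expansions. -/

/-! ### Uniqueness of the Laplace transform -/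

lemma integral_polynomial_exp_neg_mul {h : ℝ → ℝ}
    (hi : ∀ s : ℝ, 0 < s → IntegrableOn (fun t => Real.exp (-(s * t)) * h t) (Ioi 0))
    (h0 : ∀ s : ℝ, 0 < s → laplaceTransform h s = 0) (p : Polynomial ℝ) :
    IntegrableOn (fun t => p.eval (Real.exp (-t)) * (Real.exp (-t) * h t)) (Ioi 0) ∧
      ∫ t in Ioi (0 : ℝ), p.eval (Real.exp (-t)) * (Real.exp (-t) * h t) = 0 := by
  induction p using Polynomial.induction_on' with
  | add p q hp hq =>
    simp only [Polynomial.eval_add, add_mul]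
    refine ⟨hp.1.add hq.1, ?_⟩
    rw [integral_add hp.1 hq.1, hp.2, hq.2, add_zero]
  | monomial n a =>
    have key : ∀ t : ℝ, (Polynomial.monomial n a).eval (Real.exp (-t)) * (Real.exp (-t) * h t)
        = a * (Real.exp (-(((n : ℝ) + 1) * t)) * h t) := by
      intro t
      rw [Polynomial.eval_monomial, ← Real.exp_nat_mul,
        show -(((n : ℝ) + 1) * t) = n * (-t) + (-t) by ring, Real.exp_add]
      ring
    simp only [key]
    have hn : (0 : ℝ) < n + 1 := by positivity
    refine ⟨(hi _ hn).const_mul a, ?_⟩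
    rw [integral_const_mul]
    have := h0 _ hn
    rw [laplaceTransform] at this
    rw [this, mul_zero]

lemma continuousOn_comp_neg_log {φ : ℝ → ℝ} (hφ : Continuous φ) (hc : HasCompactSupport φ)
    (hs : tsupport φ ⊆ Ioi 0) : ContinuousOn (fun x => φ (-Real.log x)) (Icc 0 1) := by
  intro x hx
  rcases hx.1.eq_or_lt with rfl | hpos
  · obtain ⟨B, hB⟩ := hc.isCompact.bddAbove
    -- Since `Real.log 0 = 0`, the composite takes the value φ 0 at x = 0; it agrees with the limit
    -- there because -log x leaves the support of φ.
    have h00 : φ 0 = 0 := image_eq_zero_of_notMem_tsupport fun h => lt_irrefl (0 : ℝ) (mem_Ioi.1 (hs h))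
    have : (fun x => φ (-Real.log x)) =ᶠ[nhdsWithin 0 (Icc 0 1)] fun _ => (0 : ℝ) := by
      have h1 : ∀ᶠ x : ℝ in nhdsWithin 0 (Icc 0 1), x < Real.exp (-B) :=
        mem_nhdsWithin_of_mem_nhds (Iio_mem_nhds (Real.exp_pos _))
      filter_upwards [h1, self_mem_nhdsWithin] with y hy hy'
      rcases hy'.1.eq_or_lt with rfl | hy0
      · simp [h00]
      · refine image_eq_zero_of_notMem_tsupport fun h => ?_
        have := hB h
        have h2 := (Real.log_lt_iff_lt_exp hy0).2 hy
        linarith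
    exact (continuousWithinAt_const (b := (0 : ℝ))).congr_of_eventuallyEq this (by simp [h00])
  · exact (hφ.continuousAt.comp (Real.continuousAt_log hpos.ne').neg).continuousWithinAt

/-- The values at s = 1, 2, 3, ... already suffice: they make e^{-t} h(t) orthogonal to all
polynomials in e^{-t}, which approximate every test function uniformly. The factor e^{-t} provides
the integrability that turns uniform closeness into a small integral. -/
lemma eqOn_zero_of_laplaceTransform_eq_zero {h : ℝ → ℝ} (hc : ContinuousOn h (Ioi 0))
    (hi : ∀ s : ℝ, 0 < s → IntegrableOn (fun t => Real.exp (-(s * t)) * h t) (Ioi 0))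
    (h0 : ∀ s : ℝ, 0 < s → laplaceTransform h s = 0) : EqOn h 0 (Ioi 0) := by
  set f : ℝ → ℝ := fun t => Real.exp (-t) * h t with hf
  have hfi : IntegrableOn f (Ioi 0) := by simpa [hf] using hi 1 one_pos
  have hae : ∀ᵐ x : ℝ, x ∈ Ioi (0 : ℝ) → f x = 0 := by
    refine isOpen_Ioi.ae_eq_zero_of_integral_contDiff_smul_eq_zero hfi.locallyIntegrableOn ?_
    intro φ hφ hφc hφs
    have hset : ∫ x, φ x • f x = ∫ x in Ioi (0 : ℝ), φ x * f x := by
      rw [setIntegral_eq_integral_of_forall_compl_eq_zero]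
      · rfl
      · intro x hx
        rw [image_eq_zero_of_notMem_tsupport fun h => hx (hφs h), zero_mul]
    rw [hset]
    obtain ⟨M, hM⟩ := hφc.exists_bound_of_continuous hφ.continuous
    have hφi : IntegrableOn (fun x => φ x * f x) (Ioi 0) :=
      Integrable.bdd_mul hfi hφ.continuous.aestronglyMeasurable (Eventually.of_forall hM)
    set A := ∫ x in Ioi (0 : ℝ), |f x| with hA
    have hA0 : 0 ≤ A := integral_nonneg fun _ => abs_nonneg _
    have key : ∀ ε : ℝ, 0 < ε → |∫ x in Ioi (0 : ℝ), φ x * f x| ≤ ε * A := by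
      intro ε hε
      obtain ⟨p, hp⟩ := exists_polynomial_near_of_continuousOn 0 1 _
        (continuousOn_comp_neg_log hφ.continuous hφc hφs) ε hε
      obtain ⟨hpi, hp0⟩ := integral_polynomial_exp_neg_mul hi h0 p
      have : ∫ x in Ioi (0 : ℝ), φ x * f x
          = ∫ x in Ioi (0 : ℝ), (φ x * f x - p.eval (Real.exp (-x)) * f x) := by
        rw [integral_sub hφi hpi, hp0, sub_zero]
      rw [this, hA, ← integral_const_mul, ← Real.norm_eq_abs]
      refine norm_integral_le_of_norm_le (hfi.abs.const_mul ε) ?_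
      refine (ae_restrict_iff' measurableSet_Ioi).2 (Eventually.of_forall fun x hx => ?_)
      have h1 := hp (Real.exp (-x))
        ⟨(Real.exp_pos _).le, Real.exp_le_one_iff.2 (neg_nonpos.2 (le_of_lt hx))⟩
      rw [Real.log_exp, neg_neg, abs_sub_comm] at h1
      rw [← sub_mul, Real.norm_eq_abs, abs_mul]
      exact mul_le_mul_of_nonneg_right h1.le (abs_nonneg _)
    refine abs_eq_zero.1 (le_antisymm (le_of_forall_pos_le_add fun ε hε => ?_) (abs_nonneg _))
    -- A may vanish, hence the division by A + 1.
    refine (key (ε / (A + 1)) (by positivity)).trans ?_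
    rw [zero_add, div_mul_eq_mul_div, div_le_iff₀ (by positivity)]
    nlinarith
  have hae' : h =ᵐ[volume.restrict (Ioi 0)] fun _ => (0 : ℝ) := by
    refine (ae_restrict_iff' measurableSet_Ioi).2 ?_
    filter_upwards [hae] with x hx hx0
    simpa [hf, (Real.exp_pos _).ne'] using hx hx0
  exact Measure.eqOn_open_of_ae_eq hae' isOpen_Ioi hc continuousOn_const

/-- Uniqueness of the Laplace transform for functions continuous on `(0, ∞)`. -/
lemma eqOn_of_laplaceTransform_eq {f g : ℝ → ℝ}
    (hf : ContinuousOn f (Ioi 0)) (hg : ContinuousOn g (Ioi 0))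
    (hfi : ∀ s : ℝ, 0 < s → IntegrableOn (fun t => Real.exp (-(s * t)) * f t) (Ioi 0))
    (hgi : ∀ s : ℝ, 0 < s → IntegrableOn (fun t => Real.exp (-(s * t)) * g t) (Ioi 0))
    (h : ∀ s : ℝ, 0 < s → laplaceTransform f s = laplaceTransform g s) : EqOn f g (Ioi 0) := by
  have := eqOn_zero_of_laplaceTransform_eq_zero (h := fun t => f t - g t) (hf.sub hg)
    (fun s hs => by simp only [mul_sub]; exact (hfi s hs).sub (hgi s hs))
    (fun s hs => by
      have := h s hs
      simp only [laplaceTransform] at this ⊢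
      simp only [mul_sub]
      rw [integral_sub (hfi s hs) (hgi s hs), this, sub_self])
  intro t ht
  exact sub_eq_zero.1 (this ht)

/-! ### The denominator on the closed strip |Im u| ≤ π -/

/-- The function `1 + z + c z ^ β` in the logarithmic coordinate `z = exp u`. -/
noncomputable def powDenom (β c : ℝ) (u : ℂ) : ℂ := 1 + Complex.exp u + c * Complex.exp (β * u)

/-- The density `-π⁻¹ Im F(r e^{iπ})`, where `F(z) = (1 + z + c z ^ β)⁻¹`. -/
noncomputable def spectralDensity (β c r : ℝ) : ℝ :=
  -(Real.pi)⁻¹ * ((powDenom β c (Real.log r + Real.pi * Complex.I))⁻¹).im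

section Denominator

variable {β c : ℝ}

lemma differentiable_powDenom : Differentiable ℂ (powDenom β c) := by
  unfold powDenom; fun_prop

lemma powDenom_conj (u : ℂ) :
    powDenom β c (starRingEnd ℂ u) = starRingEnd ℂ (powDenom β c u) := by
  simp [powDenom, ← Complex.exp_conj]

lemma powDenom_im (u : ℂ) : (powDenom β c u).im =
    Real.exp u.re * Real.sin u.im + c * (Real.exp (β * u.re) * Real.sin (β * u.im)) := by
  simp [powDenom, Complex.exp_im]

lemma powDenom_ofReal (x : ℝ) :
    powDenom β c x = ((1 + Real.exp x + c * Real.exp (β * x) : ℝ) : ℂ) := by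
  simp [powDenom]

/-- On the edge Im u = π the first sine vanishes, but β < 1 keeps the second one positive. Including
this edge excludes zeros on the lips of the cut. -/
lemma powDenom_im_pos (hβ : 0 < β) (hβ1 : β < 1) (hc : 0 < c) {u : ℂ} (h0 : 0 < u.im)
    (h1 : u.im ≤ Real.pi) : 0 < (powDenom β c u).im := by
  rw [powDenom_im]
  have hs1 : 0 ≤ Real.sin u.im := Real.sin_nonneg_of_nonneg_of_le_pi h0.le h1
  have hs2 : 0 < Real.sin (β * u.im) :=
    Real.sin_pos_of_pos_of_lt_pi (by positivity) (by nlinarith)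
  positivity

lemma powDenom_ne_zero (hβ : 0 < β) (hβ1 : β < 1) (hc : 0 < c) {u : ℂ}
    (hu : |u.im| ≤ Real.pi) : powDenom β c u ≠ 0 := by
  rw [abs_le] at hu
  rcases lt_trichotomy u.im 0 with h | h | h
  · have h2 := powDenom_im_pos hβ hβ1 hc (u := starRingEnd ℂ u) (by simpa using h)
      (by rw [Complex.conj_im]; linarith)
    intro h0
    rw [powDenom_conj, h0] at h2
    simp at h2
  · have : u = (u.re : ℂ) := Complex.ext (by simp) (by simp [h])
    rw [this, powDenom_ofReal, Complex.ofReal_ne_zero]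
    positivity
  · intro h0
    have := powDenom_im_pos hβ hβ1 hc h hu.2
    rw [h0] at this
    simp at this

lemma norm_ofReal_mul_exp (hc : 0 < c) (u : ℂ) :
    ‖(c : ℂ) * Complex.exp (β * u)‖ = c * Real.exp (β * u.re) := by
  simp [Complex.norm_exp, abs_of_pos hc]

/-- The term 1 dominates far to the left and exp u far to the right; between them the strip is
compact and the denominator has no zeros. -/
lemma exists_le_norm_powDenom (hβ : 0 < β) (hβ1 : β < 1) (hc : 0 < c) :
    ∃ δ : ℝ, 0 < δ ∧ ∀ u : ℂ, |u.im| ≤ Real.pi →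
      δ * (1 + Real.exp u.re) ≤ ‖powDenom β c u‖ := by
  have hbot : Tendsto (fun x : ℝ => Real.exp x + c * Real.exp (β * x)) atBot (nhds 0) := by
    have h1 := Real.tendsto_exp_atBot.comp (tendsto_id.const_mul_atBot hβ)
    simpa using Real.tendsto_exp_atBot.add (h1.const_mul c)
  have htop : Tendsto (fun x : ℝ => Real.exp (-x) + c * Real.exp ((β - 1) * x)) atTop
      (nhds 0) := by
    have h1 := Real.tendsto_exp_atBot.comp (tendsto_id.const_mul_atTop_of_neg (sub_neg.2 hβ1))
    simpa using (Real.tendsto_exp_atBot.comp tendsto_neg_atTop_atBot).add (h1.const_mul c)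
  obtain ⟨X, hX⟩ := (hbot.eventually_lt_const (show (0 : ℝ) < 1 / 4 by norm_num)).exists_forall_of_atBot
  obtain ⟨Y, hY⟩ := (htop.eventually_lt_const (show (0 : ℝ) < 1 / 4 by norm_num)).exists_forall_of_atTop
  set S : Set ℂ := Icc X Y ×ℂ Icc (-Real.pi) Real.pi with hS
  have hScomp : IsCompact S := isCompact_Icc.reProdIm isCompact_Icc
  have hcont : ContinuousOn (fun u : ℂ => ‖powDenom β c u‖ / (1 + Real.exp u.re)) S := by
    refine ContinuousOn.div differentiable_powDenom.continuous.norm.continuousOn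
      (by fun_prop) fun u _ => by positivity
  have hmid : ∃ δ : ℝ, 0 < δ ∧ ∀ u ∈ S, δ ≤ ‖powDenom β c u‖ / (1 + Real.exp u.re) := by
    refine hScomp.exists_forall_le' hcont fun u hu => ?_
    have h := norm_pos_iff.2 (powDenom_ne_zero hβ hβ1 hc (abs_le.2 hu.2))
    positivity
  obtain ⟨δ, hδ, hδS⟩ := hmid
  refine ⟨min δ (1 / 3), by positivity, fun u hu => ?_⟩
  have hE := Real.exp_pos u.re
  have htri : ∀ a b d : ℂ, ‖a‖ - ‖b‖ - ‖d‖ ≤ ‖a + b + d‖ := by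
    intro a b d
    have h1 := norm_sub_le (a + b + d) (b + d)
    have h2 := norm_add_le b d
    rw [show a + b + d - (b + d) = a by ring] at h1
    linarith
  rcases le_or_gt u.re X with h | h
  · have h1 := hX _ h
    have h2 := htri 1 (Complex.exp u) (c * Complex.exp (β * u))
    rw [norm_ofReal_mul_exp hc, Complex.norm_exp, norm_one] at h2
    have h3 : 0 < c * Real.exp (β * u.re) := by positivity
    -- Here the norm is at least 3/4, while (1 + exp u.re)/3 is at most 5/12.
    calc _ ≤ 1 / 3 * (1 + Real.exp u.re) := by gcongr; exact min_le_right _ _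
      _ ≤ _ := by rw [powDenom]; linarith
  rcases le_or_gt Y u.re with h' | h'
  · have h1 := hY _ h'
    have h2 := htri (Complex.exp u) 1 (c * Complex.exp (β * u))
    rw [norm_ofReal_mul_exp hc, Complex.norm_exp, norm_one] at h2
    have h3 : 1 + c * Real.exp (β * u.re) ≤ 1 / 4 * Real.exp u.re := by
      have := mul_le_mul_of_nonneg_right h1.le hE.le
      rwa [add_mul, mul_assoc, ← Real.exp_add, ← Real.exp_add, neg_add_cancel, Real.exp_zero,
        show (β - 1) * u.re + u.re = β * u.re by ring] at this
    have h4 : 0 < c * Real.exp (β * u.re) := by positivity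
    calc _ ≤ 1 / 3 * (1 + Real.exp u.re) := by gcongr; exact min_le_right _ _
      _ ≤ _ := by rw [powDenom, add_comm 1 (Complex.exp u)]; linarith
  · have := hδS u ⟨⟨h.le, h'.le⟩, abs_le.1 hu⟩
    rw [le_div_iff₀ (by positivity)] at this
    refine le_trans ?_ this
    gcongr
    exact min_le_left _ _

end Denominator

/-! ### Stieltjes representation by Cauchy's theorem -/

section Stieltjes

variable {β c : ℝ}

lemma exp_ne_exp_of_abs_im_le {u : ℂ} {σ : ℝ} (hu : |u.im| ≤ Real.pi) (hne : u ≠ σ) :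
    Complex.exp u ≠ Complex.exp σ := by
  intro h
  obtain ⟨n, hn⟩ := Complex.exp_eq_exp_iff_exists_int.1 h
  have him : u.im = n * (2 * Real.pi) := by rw [hn]; simp
  have hn0 : n = 0 := by
    by_contra h0
    have h1 : (1 : ℝ) ≤ |(n : ℝ)| := by exact_mod_cast Int.one_le_abs h0
    rw [him, abs_mul, abs_of_pos Real.two_pi_pos] at hu
    nlinarith [Real.pi_pos]
  exact hne (by rw [hn, hn0]; simp)

/-- The function `(F(z) - F(s)) z / (z - s)`, `F(z) = (1 + z + c z ^ β)⁻¹`, in the coordinates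
`z = exp u`, `s = exp σ`, with its singularity at `u = σ` removed. -/
noncomputable def cauchyKernel (β c σ : ℝ) (u : ℂ) : ℂ :=
  dslope (fun v => (powDenom β c v)⁻¹) (σ : ℂ) u * Complex.exp u / dslope Complex.exp (σ : ℂ) u

lemma cauchyKernel_of_ne {σ : ℝ} {u : ℂ} (hne : u ≠ σ) :
    cauchyKernel β c σ u = ((powDenom β c u)⁻¹ - (powDenom β c σ)⁻¹) * Complex.exp u /
      (Complex.exp u - Complex.exp σ) := by
  have h : u - σ ≠ 0 := sub_ne_zero.2 hne
  rw [cauchyKernel, dslope_of_ne _ hne, dslope_of_ne _ hne, slope_def_field, slope_def_field]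
  by_cases h2 : Complex.exp u - Complex.exp σ = 0
  · simp [h2]
  · field_simp

lemma dslope_exp_ne_zero {u : ℂ} {σ : ℝ} (hu : |u.im| ≤ Real.pi) :
    dslope Complex.exp (σ : ℂ) u ≠ 0 := by
  by_cases hne : u = σ
  · rw [hne, dslope_same, Complex.deriv_exp]
    exact Complex.exp_ne_zero _
  · rw [dslope_of_ne _ hne, slope_def_field]
    exact div_ne_zero (sub_ne_zero.2 (exp_ne_exp_of_abs_im_le hu hne)) (sub_ne_zero.2 hne)

/-- Both points have exponential -r, with r = exp x, so the subtracted constant F(s) cancels and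
only the jump of F remains; its boundary values on the two lips are conjugate. -/
lemma cauchyKernel_sub (σ x : ℝ) :
    cauchyKernel β c σ (x - Real.pi * Complex.I) - cauchyKernel β c σ (x + Real.pi * Complex.I) =
      2 * Real.pi * Complex.I * ((Real.exp x *
        (spectralDensity β c (Real.exp x) / (Real.exp x + Real.exp σ)) : ℝ) : ℂ) := by
  have hπ := Real.pi_pos
  have h1 : (x - Real.pi * Complex.I : ℂ) ≠ σ := fun h => by
    have := congrArg Complex.im h; simp at this
  have h2 : (x + Real.pi * Complex.I : ℂ) ≠ σ := fun h => by
    have := congrArg Complex.im h; simp at this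
  have hconj : (x - Real.pi * Complex.I : ℂ) = starRingEnd ℂ (x + Real.pi * Complex.I) := by
    simp [sub_eq_add_neg]
  have he1 : Complex.exp (x - Real.pi * Complex.I) = -(Real.exp x : ℂ) := by
    rw [Complex.exp_sub, Complex.exp_pi_mul_I]; simp [div_neg]
  have he2 : Complex.exp (x + Real.pi * Complex.I) = -(Real.exp x : ℂ) := by
    rw [Complex.exp_add, Complex.exp_pi_mul_I]; simp
  have hD : (powDenom β c (x - Real.pi * Complex.I))⁻¹ =
      starRingEnd ℂ (powDenom β c (x + Real.pi * Complex.I))⁻¹ := by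
    rw [hconj, powDenom_conj, map_inv₀]
  rw [cauchyKernel_of_ne h1, cauchyKernel_of_ne h2, he1, he2, hD, ← Complex.ofReal_exp,
    spectralDensity, Real.log_exp]
  set z := (powDenom β c (x + Real.pi * Complex.I))⁻¹
  have hs : (Real.exp x : ℂ) + Real.exp σ ≠ 0 := by
    rw [← Complex.ofReal_add, Complex.ofReal_ne_zero]; positivity
  have hs' : -(Real.exp x : ℂ) - Real.exp σ ≠ 0 := by
    rw [show -(Real.exp x : ℂ) - Real.exp σ = -(Real.exp x + Real.exp σ) by ring]
    exact neg_ne_zero.2 hs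
  have hz : starRingEnd ℂ z - z = -(2 * z.im * Complex.I) := by
    rw [← neg_sub, Complex.sub_conj]; push_cast; ring
  have hpi : (Real.pi : ℂ) ≠ 0 := by exact_mod_cast hπ.ne'
  rw [← sub_div, ← sub_mul, sub_sub_sub_cancel_right, hz]
  push_cast at hs hs' ⊢
  rw [div_eq_iff hs']
  field_simp
  ring

variable (hβ : 0 < β) (hβ1 : β < 1) (hc : 0 < c)
include hβ hβ1 hc

lemma differentiableAt_inv_powDenom {u : ℂ} (hu : |u.im| ≤ Real.pi) :
    DifferentiableAt ℂ (fun v => (powDenom β c v)⁻¹) u :=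
  (differentiable_powDenom u).inv (powDenom_ne_zero hβ hβ1 hc hu)

lemma continuousAt_cauchyKernel {σ : ℝ} {u : ℂ} (hu : |u.im| ≤ Real.pi) :
    ContinuousAt (cauchyKernel β c σ) u := by
  refine ContinuousAt.div (ContinuousAt.mul ?_ Complex.continuous_exp.continuousAt) ?_
    (dslope_exp_ne_zero hu)
  · by_cases hne : u = σ
    · rw [hne, continuousAt_dslope_same]
      exact differentiableAt_inv_powDenom hβ hβ1 hc (by simp [Real.pi_pos.le])
    · rw [continuousAt_dslope_of_ne hne]
      exact (differentiableAt_inv_powDenom hβ hβ1 hc hu).continuousAt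
  · by_cases hne : u = σ
    · rw [hne, continuousAt_dslope_same]
      exact Complex.differentiableAt_exp
    · rw [continuousAt_dslope_of_ne hne]
      exact Complex.continuous_exp.continuousAt

lemma differentiableAt_cauchyKernel {σ : ℝ} {u : ℂ} (hu : |u.im| ≤ Real.pi) (hne : u ≠ σ) :
    DifferentiableAt ℂ (cauchyKernel β c σ) u := by
  refine DifferentiableAt.div (DifferentiableAt.mul ?_ Complex.differentiableAt_exp) ?_
    (dslope_exp_ne_zero hu)
  · exact (differentiableAt_dslope_of_ne hne).2 (differentiableAt_inv_powDenom hβ hβ1 hc hu)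
  · exact (differentiableAt_dslope_of_ne hne).2 Complex.differentiableAt_exp

/-- Subtracting F(s) has made the singularity at σ removable, so Cauchy's theorem needs only
continuity there and no residue is computed. -/
lemma integral_boundary_cauchyKernel (σ R : ℝ) :
    (∫ x : ℝ in (-R)..R, cauchyKernel β c σ (x - Real.pi * Complex.I)) -
      (∫ x : ℝ in (-R)..R, cauchyKernel β c σ (x + Real.pi * Complex.I)) +
      Complex.I * (∫ y : ℝ in (-Real.pi)..Real.pi, cauchyKernel β c σ (R + y * Complex.I)) -
      Complex.I * (∫ y : ℝ in (-Real.pi)..Real.pi,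
        cauchyKernel β c σ ((-R : ℝ) + y * Complex.I)) = 0 := by
  have hπ : -Real.pi ≤ Real.pi := by linarith [Real.pi_pos]
  have h := Complex.integral_boundary_rect_eq_zero_of_differentiable_on_off_countable
    (cauchyKernel β c σ) ⟨-R, -Real.pi⟩ ⟨R, Real.pi⟩ {(σ : ℂ)} (countable_singleton _)
    (fun u hu => by
      have := hu.2
      rw [mem_preimage, uIcc_of_le hπ] at this
      exact (continuousAt_cauchyKernel hβ hβ1 hc (abs_le.2 this)).continuousWithinAt)
    (fun u hu => by
      have := hu.1.2
      simp only [min_eq_left hπ, max_eq_right hπ] at this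
      exact differentiableAt_cauchyKernel hβ hβ1 hc (abs_le.2 ⟨this.1.le, this.2.le⟩) hu.2)
  simpa [sub_eq_add_neg] using h

lemma continuousOn_spectralDensity : ContinuousOn (spectralDensity β c) (Ioi 0) := by
  unfold spectralDensity
  refine continuousOn_const.mul (Complex.continuous_im.comp_continuousOn ?_)
  refine ContinuousOn.inv₀ (differentiable_powDenom.continuous.comp_continuousOn ?_) ?_
  · refine ContinuousOn.add ?_ continuousOn_const
    exact Complex.continuous_ofReal.comp_continuousOn
      (Real.continuousOn_log.mono fun x hx => (ne_of_gt hx))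
  · intro r _
    exact powDenom_ne_zero hβ hβ1 hc (by simp [abs_of_pos Real.pi_pos])

lemma spectralDensity_nonneg (r : ℝ) : 0 ≤ spectralDensity β c r := by
  have h := powDenom_im_pos hβ hβ1 hc (u := Real.log r + Real.pi * Complex.I)
    (by simp [Real.pi_pos]) (by simp)
  rw [spectralDensity, Complex.inv_im, neg_mul, neg_div, mul_neg, neg_neg]
  have := Real.pi_pos
  exact mul_nonneg (by positivity) (div_nonneg h.le (Complex.normSq_nonneg _))

/-- On the cut sin π = 0 removes the exp u term from the imaginary part, which leaves c r^β sin(βπ).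
Divided by the squared modulus this gives the decay r^{β-2}, integrable because β < 1; the modulus
of F alone would give only 1/r. -/
lemma integrableOn_spectralDensity : IntegrableOn (spectralDensity β c) (Ioi 0) := by
  obtain ⟨δ, hδ, hD⟩ := exists_le_norm_powDenom hβ hβ1 hc
  have hπ := Real.pi_pos
  have hi : IntegrableOn (fun r : ℝ => Real.pi⁻¹ * c * (δ ^ 2)⁻¹ * (r + 1) ^ (β - 2)) (Ioi 0) :=
    (integrableOn_add_rpow_Ioi_of_lt (by linarith) (by norm_num)).const_mul _
  refine hi.mono' ((continuousOn_spectralDensity hβ hβ1 hc).aestronglyMeasurable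
    measurableSet_Ioi) ((ae_restrict_iff' measurableSet_Ioi).2 (Eventually.of_forall ?_))
  intro r (hr : 0 < r)
  rw [Real.norm_of_nonneg (spectralDensity_nonneg hβ hβ1 hc r)]
  have h1 := hD (Real.log r + Real.pi * Complex.I) (by simp [abs_of_pos hπ])
  have him : (powDenom β c (Real.log r + Real.pi * Complex.I)).im ≤ c * r ^ β := by
    rw [powDenom_im]
    have : Real.exp (β * Real.log r) = r ^ β := by rw [Real.rpow_def_of_pos hr, mul_comm]
    simp only [Complex.add_re, Complex.ofReal_re, Complex.mul_re, Complex.I_re, mul_zero,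
      Complex.ofReal_im, Complex.I_im, mul_one, sub_self, add_zero, Complex.add_im, Complex.mul_im,
      zero_add, Real.sin_pi, this]
    gcongr
    exact mul_le_of_le_one_right (by positivity) (Real.sin_le_one _)
  rw [spectralDensity, Complex.inv_im, neg_mul, neg_div, mul_neg, neg_neg, Complex.normSq_eq_norm_sq]
  have hre : (Real.log r + Real.pi * Complex.I : ℂ).re = Real.log r := by simp
  rw [hre, Real.exp_log hr] at h1
  have h2 : (δ * (1 + r)) ^ 2 ≤ ‖powDenom β c (Real.log r + Real.pi * Complex.I)‖ ^ 2 := by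
    gcongr
  calc _ ≤ Real.pi⁻¹ * (c * r ^ β / (δ * (1 + r)) ^ 2) := by gcongr
    _ ≤ Real.pi⁻¹ * (c * (r + 1) ^ β / (δ * (1 + r)) ^ 2) := by gcongr; linarith
    _ = _ := by
      rw [Real.rpow_sub (by positivity), Real.rpow_two]
      field_simp
      ring

lemma integrableOn_spectralDensity_div {s : ℝ} (hs : 0 < s) :
    IntegrableOn (fun r => spectralDensity β c r / (r + s)) (Ioi 0) := by
  have hi := (integrableOn_spectralDensity hβ hβ1 hc).const_mul s⁻¹
  refine hi.mono' ?_ ((ae_restrict_iff' measurableSet_Ioi).2 (Eventually.of_forall ?_))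
  · refine ContinuousOn.aestronglyMeasurable ?_ measurableSet_Ioi
    exact (continuousOn_spectralDensity hβ hβ1 hc).div (by fun_prop)
      fun r (hr : 0 < r) => by positivity
  · intro r (hr : 0 < r)
    have := spectralDensity_nonneg hβ hβ1 hc r
    rw [Real.norm_of_nonneg (by positivity), div_eq_mul_inv, mul_comm]
    gcongr
    linarith

lemma tendsto_integral_spectralDensity {s : ℝ} (hs : 0 < s) :
    Tendsto (fun R : ℝ => ∫ x in (-R)..R, Real.exp x *
      (spectralDensity β c (Real.exp x) / (Real.exp x + s))) atTop
      (nhds (∫ r in Ioi (0 : ℝ), spectralDensity β c r / (r + s))) := by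
  have himg : Real.exp '' univ = Ioi 0 := by rw [image_univ, Real.range_exp]
  have hd : ∀ x ∈ (univ : Set ℝ), HasDerivWithinAt Real.exp (Real.exp x) univ x :=
    fun x _ => (Real.hasDerivAt_exp x).hasDerivWithinAt
  have h1 := integrableOn_image_iff_integrableOn_abs_deriv_smul MeasurableSet.univ hd
    Real.exp_injective.injOn (fun r => spectralDensity β c r / (r + s))
  have h2 := integral_image_eq_integral_abs_deriv_smul MeasurableSet.univ hd
    Real.exp_injective.injOn (fun r => spectralDensity β c r / (r + s))
  simp only [himg, Real.abs_exp, smul_eq_mul, integrableOn_univ, Measure.restrict_univ] at h1 h2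
  rw [h2]
  exact intervalIntegral_tendsto_integral
    (h1.1 (integrableOn_spectralDensity_div hβ hβ1 hc hs)) tendsto_neg_atTop_atBot tendsto_id

end Stieltjes

lemma tendsto_intervalIntegral_of_norm_sub_le {f : ℝ → ℝ → ℂ} {a : ℂ} {ε : ℝ → ℝ} {p q : ℝ}
    (hpq : p ≤ q) (hf : ∀ R, ContinuousOn (f R) (Icc p q)) (hε : Tendsto ε atTop (nhds 0))
    (hb : ∀ᶠ R in atTop, ∀ y ∈ Icc p q, ‖f R y - a‖ ≤ ε R) :
    Tendsto (fun R => ∫ y in p..q, f R y) atTop (nhds ((q - p : ℝ) * a)) := by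
  rw [tendsto_iff_norm_sub_tendsto_zero]
  refine squeeze_zero' (Eventually.of_forall fun _ => norm_nonneg _) ?_
    (by simpa using hε.mul_const |q - p|)
  filter_upwards [hb] with R hR
  have hi : IntervalIntegrable (f R) volume p q := by
    refine ContinuousOn.intervalIntegrable ?_
    rw [uIcc_of_le hpq]; exact hf R
  have : (∫ y in p..q, f R y) - (q - p : ℝ) * a = ∫ y in p..q, (f R y - a) := by
    rw [intervalIntegral.integral_sub hi intervalIntegrable_const,
      intervalIntegral.integral_const, Complex.real_smul]
  rw [this]
  refine intervalIntegral.norm_integral_le_of_norm_le_const fun y hy => hR y ?_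
  rw [uIoc_of_le hpq] at hy
  exact Ioc_subset_Icc_self hy

section Stieltjes

variable {β c : ℝ} (hβ : 0 < β) (hβ1 : β < 1) (hc : 0 < c)
include hβ hβ1 hc

lemma exists_norm_inv_powDenom_le : ∃ C : ℝ, 0 < C ∧ ∀ u : ℂ, |u.im| ≤ Real.pi →
    ‖(powDenom β c u)⁻¹‖ ≤ C ∧ ‖(powDenom β c u)⁻¹‖ * Real.exp u.re ≤ C := by
  obtain ⟨δ, hδ, hD⟩ := exists_le_norm_powDenom hβ hβ1 hc
  refine ⟨δ⁻¹, by positivity, fun u hu => ?_⟩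
  have h := hD u hu
  have hE := Real.exp_pos u.re
  have h1 : ‖(powDenom β c u)⁻¹‖ ≤ (δ * (1 + Real.exp u.re))⁻¹ := by
    rw [norm_inv]
    exact inv_anti₀ (by positivity) h
  have h2 : ‖(powDenom β c u)⁻¹‖ * (1 + Real.exp u.re) ≤ δ⁻¹ := by
    calc _ ≤ (δ * (1 + Real.exp u.re))⁻¹ * (1 + Real.exp u.re) := by gcongr
      _ = _ := by field_simp
  have h3 := norm_nonneg (powDenom β c u)⁻¹
  constructor <;> nlinarith

lemma continuousOn_cauchyKernel_vertical (σ R : ℝ) :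
    ContinuousOn (fun y : ℝ => cauchyKernel β c σ (R + y * Complex.I))
      (Icc (-Real.pi) Real.pi) := fun y hy => by
  have h1 : ContinuousAt (cauchyKernel β c σ) (R + y * Complex.I) :=
    continuousAt_cauchyKernel hβ hβ1 hc (by simpa using abs_le.2 hy)
  have h2 : ContinuousAt (fun y : ℝ => (R + y * Complex.I : ℂ)) y := by fun_prop
  exact (ContinuousAt.comp (f := fun y : ℝ => (R + y * Complex.I : ℂ)) h1 h2).continuousWithinAt

/-- As z F(z) is bounded and z/(z - s) tends to 1, the kernel tends uniformly to -F(s). This edge is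
where the value F(s) enters the representation. -/
lemma tendsto_cauchyKernel_atTop (σ : ℝ) :
    Tendsto (fun R : ℝ => ∫ y : ℝ in (-Real.pi)..Real.pi,
      cauchyKernel β c σ (R + y * Complex.I)) atTop
      (nhds ((Real.pi - -Real.pi : ℝ) * -(powDenom β c σ)⁻¹)) := by
  obtain ⟨C, hC, hF⟩ := exists_norm_inv_powDenom_le hβ hβ1 hc
  have hFσ := (hF σ (by simp [Real.pi_pos.le])).2
  refine tendsto_intervalIntegral_of_norm_sub_le
    (ε := fun R => (C + C) / (Real.exp R - Real.exp σ)) (by linarith [Real.pi_pos])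
    (continuousOn_cauchyKernel_vertical hβ hβ1 hc σ) ?_ ?_
  · exact tendsto_const_nhds.div_atTop
      (tendsto_atTop_add_const_right _ (-Real.exp σ) Real.tendsto_exp_atTop)
  filter_upwards [eventually_gt_atTop σ] with R hR y hy
  set u : ℂ := R + y * Complex.I with hu
  have hre : u.re = R := by simp [hu]
  have hFu := (hF u (by simpa [hu] using abs_le.2 hy)).2
  have hne : u ≠ σ := fun h => by rw [h] at hre; simp at hre; exact hR.ne hre
  have hlt : 0 < Real.exp R - Real.exp σ := sub_pos.2 (Real.exp_lt_exp.2 hR)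
  have hle : Real.exp R - Real.exp σ ≤ ‖Complex.exp u - Complex.exp σ‖ := by
    have := norm_sub_norm_le (Complex.exp u) (Complex.exp σ)
    rwa [Complex.norm_exp, Complex.norm_exp, hre, Complex.ofReal_re] at this
  have hsub : Complex.exp u - Complex.exp σ ≠ 0 := by
    intro h; rw [h, norm_zero] at hle; linarith
  have heq : cauchyKernel β c σ u - -(powDenom β c σ)⁻¹ =
      ((powDenom β c u)⁻¹ * Complex.exp u - (powDenom β c σ)⁻¹ * Complex.exp σ) /
        (Complex.exp u - Complex.exp σ) := by
    rw [cauchyKernel_of_ne hne, sub_neg_eq_add, eq_div_iff hsub, add_mul, div_mul_cancel₀ _ hsub]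
    ring
  rw [heq, norm_div]
  refine div_le_div₀ (by positivity) ?_ hlt hle
  refine (norm_sub_le _ _).trans ?_
  rw [norm_mul, norm_mul, Complex.norm_exp, Complex.norm_exp]
  exact add_le_add hFu hFσ

/-- The factor z tends to 0 while F stays bounded. -/
lemma tendsto_cauchyKernel_atBot (σ : ℝ) :
    Tendsto (fun R : ℝ => ∫ y : ℝ in (-Real.pi)..Real.pi,
      cauchyKernel β c σ ((-R : ℝ) + y * Complex.I)) atTop (nhds 0) := by
  obtain ⟨C, hC, hF⟩ := exists_norm_inv_powDenom_le hβ hβ1 hc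
  have hFσ := (hF σ (by simp [Real.pi_pos.le])).1
  have hexp : Tendsto (fun R => Real.exp (-R)) atTop (nhds 0) :=
    Real.tendsto_exp_atBot.comp tendsto_neg_atTop_atBot
  have hs := Real.exp_pos σ
  rw [← mul_zero ((Real.pi - -Real.pi : ℝ) : ℂ)]
  refine tendsto_intervalIntegral_of_norm_sub_le
    (ε := fun R => (C + C) * Real.exp (-R) / (Real.exp σ - Real.exp (-R)))
    (by linarith [Real.pi_pos]) (fun R => continuousOn_cauchyKernel_vertical hβ hβ1 hc σ (-R)) ?_ ?_
  · have := (hexp.const_mul (C + C)).div (hexp.const_sub (Real.exp σ)) (by simp [hs.ne'])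
    simpa using! this
  filter_upwards [eventually_gt_atTop (-σ)] with R hR y hy
  set u : ℂ := (-R : ℝ) + y * Complex.I with hu
  have hre : u.re = -R := by simp [hu]
  have hFu := (hF u (by simpa [hu] using abs_le.2 hy)).1
  have hne : u ≠ σ := fun h => by rw [h] at hre; simp at hre; linarith
  have hlt : 0 < Real.exp σ - Real.exp (-R) := sub_pos.2 (Real.exp_lt_exp.2 (by linarith))
  have hle : Real.exp σ - Real.exp (-R) ≤ ‖Complex.exp u - Complex.exp σ‖ := by
    have := norm_sub_norm_le (Complex.exp σ) (Complex.exp u)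
    rwa [Complex.norm_exp, Complex.norm_exp, hre, Complex.ofReal_re, norm_sub_rev] at this
  rw [sub_zero, cauchyKernel_of_ne hne, norm_div, norm_mul, Complex.norm_exp, hre]
  refine div_le_div₀ (by positivity) ?_ hlt hle
  gcongr
  exact (norm_sub_le _ _).trans (add_le_add hFu hFσ)

/-- The Stieltjes representation of `s ↦ (1 + s + c s ^ β)⁻¹`. -/
lemma integral_spectralDensity_div {s : ℝ} (hs : 0 < s) :
    ∫ r in Ioi (0 : ℝ), spectralDensity β c r / (r + s) = (1 + s + c * s ^ β)⁻¹ := by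
  set σ := Real.log s
  have hσ : Real.exp σ = s := Real.exp_log hs
  have hD : powDenom β c σ = ((1 + s + c * s ^ β : ℝ) : ℂ) := by
    rw [powDenom_ofReal, hσ, Real.rpow_def_of_pos hs, mul_comm β]
  set J : ℝ → ℝ := fun R => ∫ x in (-R)..R, Real.exp x *
      (spectralDensity β c (Real.exp x) / (Real.exp x + s)) with hJ
  have hπ := Real.pi_pos
  have hcont : ∀ ε : ℝ, |ε| ≤ 1 →
      Continuous fun x : ℝ => cauchyKernel β c σ (x + (ε * Real.pi : ℝ) * Complex.I) := by
    intro ε hε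
    refine continuous_iff_continuousAt.2 fun x => ?_
    have h1 : ContinuousAt (cauchyKernel β c σ) (x + (ε * Real.pi : ℝ) * Complex.I) := by
      refine continuousAt_cauchyKernel hβ hβ1 hc ?_
      have : |ε * Real.pi| ≤ Real.pi := by
        rw [abs_mul, abs_of_pos hπ]; nlinarith
      simpa using this
    have h2 : ContinuousAt (fun x : ℝ => (x + (ε * Real.pi : ℝ) * Complex.I : ℂ)) x := by fun_prop
    exact ContinuousAt.comp (f := fun x : ℝ => (x + (ε * Real.pi : ℝ) * Complex.I : ℂ)) h1 h2
  have hlim := ((Complex.continuous_ofReal.tendsto _).comp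
    (tendsto_integral_spectralDensity hβ hβ1 hc hs)).const_mul (2 * Real.pi * Complex.I)
  have hlim2 := (hlim.add ((tendsto_cauchyKernel_atTop hβ hβ1 hc σ).const_mul Complex.I)).sub
    ((tendsto_cauchyKernel_atBot hβ hβ1 hc σ).const_mul Complex.I)
  have hzero : ∀ R : ℝ, 2 * Real.pi * Complex.I * (J R : ℂ) +
      Complex.I * (∫ y : ℝ in (-Real.pi)..Real.pi, cauchyKernel β c σ (R + y * Complex.I)) -
      Complex.I * (∫ y : ℝ in (-Real.pi)..Real.pi,
        cauchyKernel β c σ ((-R : ℝ) + y * Complex.I)) = 0 := by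
    intro R
    have h := integral_boundary_cauchyKernel hβ hβ1 hc σ R
    rw [← intervalIntegral.integral_sub] at h
    · simp only [cauchyKernel_sub, hσ] at h
      rw [intervalIntegral.integral_const_mul, intervalIntegral.integral_ofReal] at h
      exact h
    · have := hcont (-1) (by simp)
      simp only [neg_mul, one_mul, Complex.ofReal_neg, ← sub_eq_add_neg] at this
      exact this.intervalIntegrable _ _
    · have := hcont 1 (by simp)
      simp only [one_mul] at this
      exact this.intervalIntegrable _ _
  -- In the limit, 2πi ∫ K(r)/(r+s) dr - 2πi F(s) = 0.
  have hfin := tendsto_nhds_unique (hlim2.congr hzero) tendsto_const_nhds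
  rw [hD] at hfin
  have hpi : (Real.pi : ℂ) ≠ 0 := by exact_mod_cast hπ.ne'
  have h3 : (2 * Real.pi * Complex.I : ℂ) *
      (((∫ r in Ioi (0 : ℝ), spectralDensity β c r / (r + s) : ℝ) : ℂ) -
        (((1 + s + c * s ^ β)⁻¹ : ℝ) : ℂ)) = 0 := by
    rw [← hfin]
    push_cast
    ring
  have h4 := (mul_eq_zero.1 h3).resolve_left (by simp [hpi])
  exact_mod_cast sub_eq_zero.1 h4

end Stieltjes

/-! ### Inverting F as a Laplace integral of the density -/

/-- The Laplace transform of the spectral density. -/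
noncomputable def spectralLaplace (β c t : ℝ) : ℝ :=
  ∫ r in Ioi (0 : ℝ), Real.exp (-(r * t)) * spectralDensity β c r

lemma integrableOn_exp_neg_mul_Ioi {a : ℝ} (ha : 0 < a) :
    IntegrableOn (fun t => Real.exp (-(a * t))) (Ioi 0) := by
  simpa only [neg_mul] using integrableOn_exp_mul_Ioi (neg_neg_of_pos ha) 0

lemma integral_exp_neg_mul_Ioi {a : ℝ} (ha : 0 < a) :
    ∫ t in Ioi (0 : ℝ), Real.exp (-(a * t)) = a⁻¹ := by
  have := integral_exp_mul_Ioi (neg_neg_of_pos ha) 0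
  simp only [neg_mul] at this
  rw [this]
  simp

section SpectralLaplace

variable {β c : ℝ} (hβ : 0 < β) (hβ1 : β < 1) (hc : 0 < c)
include hβ hβ1 hc

lemma integrableOn_exp_mul_spectralDensity {t : ℝ} (ht : 0 ≤ t) :
    IntegrableOn (fun r => Real.exp (-(r * t)) * spectralDensity β c r) (Ioi 0) := by
  refine Integrable.bdd_mul (c := 1) (integrableOn_spectralDensity hβ hβ1 hc)
    (by fun_prop) ((ae_restrict_iff' measurableSet_Ioi).2 (Eventually.of_forall ?_))
  intro r (hr : 0 < r)
  rw [Real.norm_of_nonneg (Real.exp_pos _).le, Real.exp_le_one_iff]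
  nlinarith

lemma continuousOn_spectralLaplace : ContinuousOn (spectralLaplace β c) (Ioi 0) := by
  refine continuousOn_of_dominated (bound := spectralDensity β c) ?_ ?_
    (integrableOn_spectralDensity hβ hβ1 hc) ?_
  · exact fun t ht =>
      (integrableOn_exp_mul_spectralDensity hβ hβ1 hc (le_of_lt ht)).aestronglyMeasurable
  · intro t (ht : 0 < t)
    refine (ae_restrict_iff' measurableSet_Ioi).2 (Eventually.of_forall fun r (hr : 0 < r) => ?_)
    have hK := spectralDensity_nonneg hβ hβ1 hc r
    rw [Real.norm_of_nonneg (by positivity)]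
    exact mul_le_of_le_one_left hK (Real.exp_le_one_iff.2 (by nlinarith))
  · exact Eventually.of_forall fun r => by fun_prop

/-- All factors are nonnegative, and integrating out t leaves K(r)/(r+s), whose integrability is
known. -/
lemma integrable_prod_spectralDensity {s : ℝ} (hs : 0 < s) :
    Integrable (fun p : ℝ × ℝ =>
      Real.exp (-(s * p.1)) * (Real.exp (-(p.2 * p.1)) * spectralDensity β c p.2))
      ((volume.restrict (Ioi 0)).prod (volume.restrict (Ioi 0))) := by
  have hmeas : AEStronglyMeasurable (fun p : ℝ × ℝ =>
      Real.exp (-(s * p.1)) * (Real.exp (-(p.2 * p.1)) * spectralDensity β c p.2))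
      ((volume.restrict (Ioi (0 : ℝ))).prod (volume.restrict (Ioi (0 : ℝ)))) := by
    have h1 : AEStronglyMeasurable (fun p : ℝ × ℝ => spectralDensity β c p.2)
        ((volume.restrict (Ioi (0 : ℝ))).prod (volume.restrict (Ioi (0 : ℝ)))) :=
      (integrableOn_spectralDensity hβ hβ1 hc).aestronglyMeasurable.comp_snd
    refine AEStronglyMeasurable.mul (by fun_prop) (AEStronglyMeasurable.mul (by fun_prop) h1)
  have heq : ∀ t r : ℝ, Real.exp (-(s * t)) * (Real.exp (-(r * t)) * spectralDensity β c r)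
      = spectralDensity β c r * Real.exp (-((r + s) * t)) := by
    intro t r
    rw [← mul_assoc, ← Real.exp_add, mul_comm]
    ring_nf
  refine (integrable_prod_iff' hmeas).2 ⟨?_, ?_⟩
  · refine (ae_restrict_iff' measurableSet_Ioi).2 (Eventually.of_forall fun r (hr : 0 < r) => ?_)
    simp only [heq]
    exact (integrableOn_exp_neg_mul_Ioi (by positivity)).const_mul _
  · refine (integrableOn_spectralDensity_div hβ hβ1 hc hs).congr ?_
    refine (ae_restrict_iff' measurableSet_Ioi).2 (Eventually.of_forall fun r (hr : 0 < r) => ?_)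
    have hK := spectralDensity_nonneg hβ hβ1 hc r
    simp only [heq, norm_mul, Real.norm_of_nonneg hK, Real.norm_of_nonneg (Real.exp_pos _).le]
    rw [integral_const_mul, integral_exp_neg_mul_Ioi (by positivity), div_eq_mul_inv]

lemma integrableOn_exp_mul_spectralLaplace {s : ℝ} (hs : 0 < s) :
    IntegrableOn (fun t => Real.exp (-(s * t)) * spectralLaplace β c t) (Ioi 0) := by
  have := (integrable_prod_spectralDensity hβ hβ1 hc hs).integral_prod_left
  simp only [integral_const_mul] at this
  exact this

lemma laplaceTransform_spectralLaplace {s : ℝ} (hs : 0 < s) :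
    laplaceTransform (spectralLaplace β c) s = (1 + s + c * s ^ β)⁻¹ := by
  have h := integral_integral_swap (f := fun t r : ℝ =>
    Real.exp (-(s * t)) * (Real.exp (-(r * t)) * spectralDensity β c r))
    (integrable_prod_spectralDensity hβ hβ1 hc hs)
  simp only [integral_const_mul] at h
  rw [laplaceTransform, ← integral_spectralDensity_div hβ hβ1 hc hs]
  refine h.trans (setIntegral_congr_fun measurableSet_Ioi fun r (hr : 0 < r) => ?_)
  have heq : ∀ t : ℝ, Real.exp (-(s * t)) * (Real.exp (-(r * t)) * spectralDensity β c r)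
      = spectralDensity β c r * Real.exp (-((r + s) * t)) := by
    intro t
    rw [← mul_assoc, ← Real.exp_add, mul_comm]
    ring_nf
  simp only [heq]
  rw [integral_const_mul, integral_exp_neg_mul_Ioi (by positivity), div_eq_mul_inv]

end SpectralLaplace

/-! ### Watson's lemma for the density -/

lemma inv_Gamma_neg {d : ℝ} (hd : 0 ≤ d) :
    (Real.Gamma (-d))⁻¹ = -Real.pi⁻¹ * Real.sin (d * Real.pi) * Real.Gamma (d + 1) := by
  have h := Real.Gamma_mul_Gamma_one_sub (-d)
  have hG : Real.Gamma (d + 1) ≠ 0 := (Real.Gamma_pos_of_pos (by positivity)).ne'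
  have hπ := Real.pi_ne_zero
  rw [sub_neg_eq_add, add_comm 1 d, mul_neg, Real.sin_neg, mul_comm Real.pi] at h
  -- A zero of the sine is a pole of Γ(-d); there both sides are 0 by the convention `Gamma = 0`.
  by_cases hs : Real.sin (d * Real.pi) = 0
  · rw [hs, neg_zero, div_zero] at h
    rw [(mul_eq_zero.1 h).resolve_right hG, hs]
    simp
  · rw [eq_div_iff (neg_ne_zero.2 hs)] at h
    refine inv_eq_of_mul_eq_one_right ?_
    calc _ = Real.pi⁻¹ * (Real.Gamma (-d) * Real.Gamma (d + 1) * -Real.sin (d * Real.pi)) := by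
          ring
      _ = 1 := by rw [h, inv_mul_cancel₀ hπ]

lemma integral_Ioi_exp_neg_mul_mul_rpow {d t : ℝ} (hd : 0 ≤ d) (ht : 0 < t) :
    IntegrableOn (fun r : ℝ => Real.exp (-(r * t)) * r ^ d) (Ioi 0) ∧
      ∫ r in Ioi (0 : ℝ), Real.exp (-(r * t)) * r ^ d = Real.Gamma (d + 1) * t ^ (-d - 1) := by
  have h := Real.integral_rpow_mul_exp_neg_mul_Ioi (a := d + 1) (by positivity) ht
  have heq : ∀ r : ℝ, r ^ (d + 1 - 1) * Real.exp (-(t * r)) = Real.exp (-(r * t)) * r ^ d := by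
    intro r
    rw [add_sub_cancel_right, mul_comm, mul_comm t]
  simp only [heq] at h
  have hpow : (1 / t) ^ (d + 1) = t ^ (-d - 1) := by
    rw [one_div, Real.inv_rpow ht.le, ← Real.rpow_neg ht.le]
    ring_nf
  rw [hpow, mul_comm] at h
  -- A nonintegrable function has integral 0 by convention, so a nonzero value proves integrability.
  refine ⟨.of_integral_ne_zero ?_, h⟩
  rw [h]
  exact mul_ne_zero (Real.Gamma_pos_of_pos (by positivity)).ne' (Real.rpow_pos_of_pos ht _).ne'

/-- The terms of order less than `N` in the expansion of `spectralDensity (1 - α) c` at `0`. -/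
noncomputable def spectralSum (α c : ℝ) (N : ℕ) (r : ℝ) : ℝ :=
  ∑ k ∈ Finset.range N, (-1 : ℝ) ^ k * ∑ l ∈ Finset.range (k + 1),
    (k.choose l : ℝ) * c ^ l *
      (-Real.pi⁻¹ * Real.sin (((k : ℝ) - l * α) * Real.pi) * r ^ ((k : ℝ) - l * α))

lemma im_powDenom_sub_one_pow (α c : ℝ) (k : ℕ) {r : ℝ} (hr : 0 < r) :
    ((powDenom (1 - α) c (Real.log r + Real.pi * Complex.I) - 1) ^ k).im =
      ∑ l ∈ Finset.range (k + 1), (k.choose l : ℝ) * c ^ l *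
        (Real.sin (((k : ℝ) - l * α) * Real.pi) * r ^ ((k : ℝ) - l * α)) := by
  set u : ℂ := Real.log r + Real.pi * Complex.I with hu
  have h1 : powDenom (1 - α) c u - 1 =
      c * Complex.exp (((1 - α : ℝ) : ℂ) * u) + Complex.exp u := by rw [powDenom]; ring
  rw [h1, add_pow, Complex.im_sum]
  refine Finset.sum_congr rfl fun l hl => ?_
  have hlk : l ≤ k := Nat.lt_succ_iff.1 (Finset.mem_range.1 hl)
  have h2 : (c * Complex.exp (((1 - α : ℝ) : ℂ) * u)) ^ l * Complex.exp u ^ (k - l) * k.choose l =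
      ((k.choose l * c ^ l : ℝ) : ℂ) * Complex.exp (((k - l * α : ℝ) : ℂ) * u) := by
    rw [mul_pow, ← Complex.exp_nat_mul, ← Complex.exp_nat_mul, mul_assoc (_ ^ l), ← Complex.exp_add,
      Nat.cast_sub hlk]
    push_cast
    rw [show (l : ℂ) * ((1 - α) * u) + (k - l) * u = (k - l * α) * u by ring]
    ring
  rw [h2, Complex.im_ofReal_mul, Complex.exp_im, Complex.re_ofReal_mul, Complex.im_ofReal_mul]
  have hre : u.re = Real.log r := by simp [hu]
  have him : u.im = Real.pi := by simp [hu]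
  rw [hre, him, Real.rpow_def_of_pos hr, mul_comm (Real.log r)]
  ring

/-- The remainder of the geometric series is (1 - D)^N / D, where D is the denominator on the cut.
Since 1/D is bounded on the whole strip, the estimate holds for every r > 0. -/
lemma exists_abs_spectralDensity_sub_le {α c : ℝ} (hα : 0 < α) (hα1 : α < 1) (hc : 0 < c)
    (N : ℕ) : ∃ A : ℝ, 0 < A ∧ ∀ r : ℝ, 0 < r →
      |spectralDensity (1 - α) c r - spectralSum α c N r| ≤
        A * (r ^ (N : ℝ) + r ^ (N * (1 - α))) := by
  have hπ := Real.pi_pos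
  obtain ⟨C, hC, hF⟩ := exists_norm_inv_powDenom_le (sub_pos.2 hα1) (by linarith) hc
  refine ⟨Real.pi⁻¹ * C * (2 ^ (N - 1) * (1 + c ^ N)), by positivity, fun r hr => ?_⟩
  set u : ℂ := Real.log r + Real.pi * Complex.I with hu
  set D := powDenom (1 - α) c u with hD
  have huim : |u.im| ≤ Real.pi := by simp [hu, abs_of_pos hπ]
  have hD0 : D ≠ 0 := powDenom_ne_zero (sub_pos.2 hα1) (by linarith) hc huim
  have hgeom : D⁻¹ = ∑ k ∈ Finset.range N, (-(D - 1)) ^ k + (-(D - 1)) ^ N * D⁻¹ := by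
    have := mul_neg_geom_sum (-(D - 1)) N
    rw [sub_neg_eq_add, add_sub_cancel] at this
    field_simp
    rw [this]
    ring
  have hsum : spectralSum α c N r =
      -Real.pi⁻¹ * (∑ k ∈ Finset.range N, (-(D - 1)) ^ k).im := by
    rw [spectralSum, Complex.im_sum, Finset.mul_sum]
    refine Finset.sum_congr rfl fun k _ => ?_
    have h1 : (-(D - 1)) ^ k = (((-1 : ℝ) ^ k : ℝ) : ℂ) * (D - 1) ^ k := by
      rw [neg_pow]; push_cast; ring
    rw [h1, Complex.im_ofReal_mul, hD, hu, im_powDenom_sub_one_pow α c k hr, Finset.mul_sum,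
      Finset.mul_sum, Finset.mul_sum]
    refine Finset.sum_congr rfl fun l _ => ?_
    ring
  have hK : spectralDensity (1 - α) c r = -Real.pi⁻¹ * (D⁻¹).im := rfl
  have hw : ‖D - 1‖ ≤ r + c * r ^ (1 - α) := by
    have h1 : D - 1 = Complex.exp u + c * Complex.exp (((1 - α : ℝ) : ℂ) * u) := by
      rw [hD, powDenom]; ring
    have hre : u.re = Real.log r := by simp [hu]
    rw [h1, Real.rpow_def_of_pos hr, mul_comm (Real.log r)]
    refine (norm_add_le _ _).trans ?_
    rw [norm_ofReal_mul_exp hc, Complex.norm_exp, hre, Real.exp_log hr]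
  have hdiff : spectralDensity (1 - α) c r - spectralSum α c N r =
      -Real.pi⁻¹ * ((-(D - 1)) ^ N * D⁻¹).im := by
    rw [hK, hsum, ← mul_sub, ← Complex.sub_im]
    congr 2
    rw [sub_eq_iff_eq_add']
    exact hgeom
  rw [hdiff, abs_mul, abs_neg, abs_of_pos (inv_pos.2 hπ)]
  have hcr : 0 ≤ c * r ^ (1 - α) := by positivity
  calc _ ≤ Real.pi⁻¹ * ‖(-(D - 1)) ^ N * D⁻¹‖ := by gcongr; exact Complex.abs_im_le_norm _
    _ = Real.pi⁻¹ * (‖D - 1‖ ^ N * ‖D⁻¹‖) := by rw [norm_mul, norm_pow, norm_neg]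
    _ ≤ Real.pi⁻¹ * ((r + c * r ^ (1 - α)) ^ N * C) := by
      gcongr
      exact (hF u huim).1
    _ ≤ Real.pi⁻¹ * ((2 ^ (N - 1) * (r ^ N + (c * r ^ (1 - α)) ^ N)) * C) := by
      gcongr
      exact add_pow_le hr.le hcr N
    _ = Real.pi⁻¹ * C * (2 ^ (N - 1) * (r ^ (N : ℝ) + c ^ N * r ^ (N * (1 - α)))) := by
      rw [mul_pow, ← Real.rpow_mul_natCast hr.le, mul_comm (1 - α), Real.rpow_natCast]
      ring
    _ ≤ _ := by
      have h1 : 0 < r ^ (N : ℝ) := by positivity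
      have h2 : 0 < r ^ (N * (1 - α)) := by positivity
      have h3 : 0 < c ^ N := by positivity
      rw [mul_assoc _ _ (r ^ (N : ℝ) + _), mul_assoc _ (1 + c ^ N)]
      gcongr
      nlinarith [mul_pos h3 h1]

lemma integral_exp_mul_spectralSum {α : ℝ} (hα1 : α < 1) (N : ℕ) {t : ℝ}
    (ht : 0 < t) :
    IntegrableOn (fun r => Real.exp (-(r * t)) * spectralSum α (Real.Gamma (1 + α)) N r) (Ioi 0) ∧
      ∫ r in Ioi (0 : ℝ), Real.exp (-(r * t)) * spectralSum α (Real.Gamma (1 + α)) N r =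
        andradeLongTimeSum α N t := by
  have hterm : ∀ k l : ℕ, l ∈ Finset.range (k + 1) →
      IntegrableOn (fun r : ℝ => Real.exp (-(r * t)) * r ^ ((k : ℝ) - l * α)) (Ioi 0) ∧
      (-Real.pi⁻¹ * Real.sin (((k : ℝ) - l * α) * Real.pi)) *
        ∫ r in Ioi (0 : ℝ), Real.exp (-(r * t)) * r ^ ((k : ℝ) - l * α) =
        inverseLaplacePower ((k : ℝ) - l * α) t := by
    intro k l hl
    have hlk : (l : ℝ) ≤ k := by exact_mod_cast Nat.lt_succ_iff.1 (Finset.mem_range.1 hl)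
    have hd : 0 ≤ (k : ℝ) - l * α := by nlinarith [(Nat.cast_nonneg l : (0 : ℝ) ≤ l)]
    obtain ⟨h1, h2⟩ := integral_Ioi_exp_neg_mul_mul_rpow hd ht
    refine ⟨h1, ?_⟩
    rw [h2, inverseLaplacePower, inv_Gamma_neg hd]
    ring
  have hfun : ∀ r : ℝ, Real.exp (-(r * t)) * spectralSum α (Real.Gamma (1 + α)) N r =
      ∑ k ∈ Finset.range N, ∑ l ∈ Finset.range (k + 1), ((-1 : ℝ) ^ k *
        ((k.choose l : ℝ) * Real.Gamma (1 + α) ^ l *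
        (-Real.pi⁻¹ * Real.sin (((k : ℝ) - l * α) * Real.pi)))) *
          (Real.exp (-(r * t)) * r ^ ((k : ℝ) - l * α)) := by
    intro r
    rw [spectralSum, Finset.mul_sum]
    refine Finset.sum_congr rfl fun k _ => ?_
    rw [Finset.mul_sum, Finset.mul_sum]
    refine Finset.sum_congr rfl fun l _ => ?_
    ring
  simp only [hfun]
  have hi : ∀ k, ∀ l ∈ Finset.range (k + 1), IntegrableOn (fun r : ℝ => ((-1 : ℝ) ^ k *
        ((k.choose l : ℝ) * Real.Gamma (1 + α) ^ l *
        (-Real.pi⁻¹ * Real.sin (((k : ℝ) - l * α) * Real.pi)))) *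
          (Real.exp (-(r * t)) * r ^ ((k : ℝ) - l * α))) (Ioi 0) :=
    fun k l hl => (hterm k l hl).1.const_mul _
  refine ⟨integrable_finsetSum _ fun k _ => integrable_finsetSum _ (hi k), ?_⟩
  rw [integral_finsetSum _ fun k _ => integrable_finsetSum _ (hi k), andradeLongTimeSum]
  refine Finset.sum_congr rfl fun k _ => ?_
  rw [integral_finsetSum _ (hi k), Finset.mul_sum]
  refine Finset.sum_congr rfl fun l hl => ?_
  rw [integral_const_mul, ← (hterm k l hl).2]
  ring

lemma isBigO_spectralLaplace_sub {α : ℝ} (hα : 0 < α) (hα1 : α < 1) (N : ℕ) :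
    (fun t => spectralLaplace (1 - α) (Real.Gamma (1 + α)) t - andradeLongTimeSum α N t)
      =O[atTop] fun t : ℝ => t ^ (-((N : ℝ) * (1 - α)) - 1) := by
  have hc : 0 < Real.Gamma (1 + α) := Real.Gamma_pos_of_pos (by linarith)
  obtain ⟨A, hA, hb⟩ := exists_abs_spectralDensity_sub_le hα hα1 hc N
  have hN : (0 : ℝ) ≤ N := Nat.cast_nonneg N
  have hd : 0 ≤ (N : ℝ) * (1 - α) := mul_nonneg hN (by linarith)
  refine IsBigO.of_bound
    (A * (Real.Gamma (N + 1) + Real.Gamma (N * (1 - α) + 1))) ?_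
  filter_upwards [eventually_ge_atTop 1] with t ht
  have ht0 : 0 < t := by linarith
  obtain ⟨hSi, hS⟩ := integral_exp_mul_spectralSum hα1 N ht0
  have hKi := integrableOn_exp_mul_spectralDensity (sub_pos.2 hα1) (by linarith) hc ht0.le
  obtain ⟨h1i, h1⟩ := integral_Ioi_exp_neg_mul_mul_rpow hN ht0
  obtain ⟨h2i, h2⟩ := integral_Ioi_exp_neg_mul_mul_rpow hd ht0
  rw [spectralLaplace, ← hS, ← integral_sub hKi hSi]
  -- For t ≥ 1 the slower decay, coming from r^{N(1-α)}, absorbs the other term.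
  have hle : t ^ (-(N : ℝ) - 1) ≤ t ^ (-((N : ℝ) * (1 - α)) - 1) :=
    Real.rpow_le_rpow_of_exponent_le ht (by nlinarith)
  have hG1 : 0 < Real.Gamma ((N : ℝ) + 1) := Real.Gamma_pos_of_pos (by positivity)
  calc _ ≤ ∫ r in Ioi (0 : ℝ), A * (Real.exp (-(r * t)) * r ^ (N : ℝ) +
          Real.exp (-(r * t)) * r ^ ((N : ℝ) * (1 - α))) := by
        refine norm_integral_le_of_norm_le ((h1i.add h2i).const_mul A)
          ((ae_restrict_iff' measurableSet_Ioi).2 (Eventually.of_forall fun r hr => ?_))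
        have hE := Real.exp_pos (-(r * t))
        rw [← mul_sub, norm_mul, Real.norm_of_nonneg hE.le, Real.norm_eq_abs]
        calc _ ≤ Real.exp (-(r * t)) * (A * (r ^ (N : ℝ) + r ^ (N * (1 - α)))) := by
              gcongr; exact hb r hr
          _ = _ := by ring
    _ = A * (Real.Gamma (N + 1) * t ^ (-(N : ℝ) - 1) +
          Real.Gamma (N * (1 - α) + 1) * t ^ (-((N : ℝ) * (1 - α)) - 1)) := by
        rw [integral_const_mul, integral_add h1i h2i, h1, h2]
    _ ≤ A * (Real.Gamma (N + 1) * t ^ (-((N : ℝ) * (1 - α)) - 1) +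
          Real.Gamma (N * (1 - α) + 1) * t ^ (-((N : ℝ) * (1 - α)) - 1)) := by gcongr
    _ = _ := by
        rw [Real.norm_of_nonneg (Real.rpow_nonneg ht0.le _)]
        ring

/-! ### The Andrade model: scaling and explicit coefficients -/

lemma laplaceTransform_comp_div (f : ℝ → ℝ) {τ : ℝ} (hτ : 0 < τ) (a s : ℝ) :
    laplaceTransform (fun t => a * f (t / τ)) s = a * τ * laplaceTransform f (s * τ) := by
  have h := integral_comp_mul_left_Ioi (fun x => Real.exp (-(s * τ * x)) * f x) 0 (inv_pos.2 hτ)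
  rw [mul_zero, inv_inv, smul_eq_mul] at h
  rw [laplaceTransform, laplaceTransform, mul_assoc, ← h, ← integral_const_mul]
  congr 1
  ext t
  rw [show s * τ * (τ⁻¹ * t) = s * t by field_simp, inv_mul_eq_div]
  ring

lemma laplaceTransform_andradeCreepCompliance {α μ τ s : ℝ} (hα : 0 < α) (hτ : 0 < τ)
    (hs : 0 < s) : laplaceTransform (andradeCreepCompliance α μ τ) s =
      1 / μ * τ * ((1 + s * τ + Real.Gamma (1 + α) * (s * τ) ^ (1 - α)) / (s * τ) ^ 2) := by
  have hp : 0 < s * τ := by positivity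
  have h := laplaceTransform_comp_div (fun x => 1 + x ^ α + x) hτ (1 / μ) s
  unfold andradeCreepCompliance
  rw [h]
  congr 1
  obtain ⟨i0, h0⟩ := integral_Ioi_exp_neg_mul_mul_rpow le_rfl hp
  obtain ⟨iα, hα'⟩ := integral_Ioi_exp_neg_mul_mul_rpow hα.le hp
  obtain ⟨i1, h1⟩ := integral_Ioi_exp_neg_mul_mul_rpow zero_le_one hp
  have hfun : ∀ x : ℝ, Real.exp (-(s * τ * x)) * (1 + x ^ α + x) =
      Real.exp (-(x * (s * τ))) * x ^ (0 : ℝ) + Real.exp (-(x * (s * τ))) * x ^ α +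
        Real.exp (-(x * (s * τ))) * x ^ (1 : ℝ) := by
    intro x
    rw [Real.rpow_zero, Real.rpow_one, mul_comm x]
    ring
  rw [laplaceTransform]
  simp only [hfun]
  have i2 : IntegrableOn (fun x : ℝ => Real.exp (-(x * (s * τ))) * x ^ (0 : ℝ) +
      Real.exp (-(x * (s * τ))) * x ^ α) (Ioi 0) := i0.add iα
  rw [integral_add i2 i1, integral_add i0 iα, h0, hα', h1]
  have e0 : (s * τ) ^ (-0 - 1 : ℝ) = (s * τ) / (s * τ) ^ 2 := by
    rw [neg_zero, zero_sub, Real.rpow_neg_one]; field_simp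
  have e1 : (s * τ) ^ (-1 - 1 : ℝ) = 1 / (s * τ) ^ 2 := by
    rw [show (-1 - 1 : ℝ) = -(2 : ℕ) by norm_num, Real.rpow_neg hp.le, Real.rpow_natCast, one_div]
  have eα : (s * τ) ^ (-α - 1 : ℝ) = (s * τ) ^ (1 - α) / (s * τ) ^ 2 := by
    rw [show -α - 1 = (1 - α) - (2 : ℕ) by push_cast; ring, Real.rpow_sub hp, Real.rpow_natCast]
  rw [e0, e1, eα, zero_add, Real.Gamma_one, add_comm α 1, show (1 : ℝ) + 1 = 2 by norm_num,
    Real.Gamma_two]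
  ring

/-- The relaxation modulus of the Andrade model. -/
noncomputable def andradeRelaxationModulus (α μ τ t : ℝ) : ℝ :=
  μ * spectralLaplace (1 - α) (Real.Gamma (1 + α)) (t / τ)

section Andrade

variable {α μ τ : ℝ} (hα : 0 < α) (hα1 : α < 1) (hμ : 0 < μ) (hτ : 0 < τ)

include hα hα1 hμ hτ in
lemma isRelaxationModulus_andradeRelaxationModulus :
    IsRelaxationModulus (andradeCreepCompliance α μ τ) (andradeRelaxationModulus α μ τ) := by
  have hc : 0 < Real.Gamma (1 + α) := Real.Gamma_pos_of_pos (by linarith)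
  have hβ : 0 < 1 - α := sub_pos.2 hα1
  have hβ1 : 1 - α < 1 := by linarith
  refine ⟨?_, fun s hs => ?_, fun s hs => ?_⟩
  · refine continuousOn_const.mul ((continuousOn_spectralLaplace hβ hβ1 hc).comp
      (by fun_prop) fun t (ht : 0 < t) => ?_)
    exact div_pos ht hτ
  · have h := integrableOn_exp_mul_spectralLaplace hβ hβ1 hc (s := s * τ) (by positivity)
    rw [← mul_zero τ⁻¹, ← integrableOn_Ioi_comp_mul_left_iff _ _ (inv_pos.2 hτ)] at h
    refine (h.const_mul μ).congr (Eventually.of_forall fun t => ?_)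
    simp only [andradeRelaxationModulus]
    rw [show s * τ * (τ⁻¹ * t) = s * t by field_simp, inv_mul_eq_div]
    ring
  · have hp : 0 < s * τ := by positivity
    have h := laplaceTransform_comp_div (spectralLaplace (1 - α) (Real.Gamma (1 + α))) hτ μ s
    unfold andradeRelaxationModulus
    rw [h, laplaceTransform_andradeCreepCompliance hα hτ hs,
      laplaceTransform_spectralLaplace hβ hβ1 hc hp]
    have hpos : 0 < 1 + s * τ + Real.Gamma (1 + α) * (s * τ) ^ (1 - α) := by positivity
    field_simp

lemma IsRelaxationModulus.eqOn {J G G' : ℝ → ℝ} (h : IsRelaxationModulus J G)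
    (h' : IsRelaxationModulus J G') : EqOn G G' (Ioi 0) := by
  refine eqOn_of_laplaceTransform_eq h.continuousOn h'.continuousOn h.integrableOn
    h'.integrableOn fun s hs => ?_
  have h1 := h.laplace_mul s hs
  have hJ : laplaceTransform J s ≠ 0 := by
    intro h0
    rw [h0, zero_mul] at h1
    exact (one_div_pos.2 (pow_pos hs 2)).ne h1
  exact mul_left_cancel₀ hJ (h1.trans (h'.laplace_mul s hs).symm)

include hα hα1 in
lemma inv_Gamma_sub_one_mul :
    -(Real.Gamma (1 + α) * (Real.Gamma (α - 1))⁻¹) = α * (1 - α) := by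
  have h1 : Real.Gamma (1 + α) = α * Real.Gamma α := by
    rw [add_comm, Real.Gamma_add_one hα.ne']
  have h2 : Real.Gamma α = (α - 1) * Real.Gamma (α - 1) := by
    rw [← Real.Gamma_add_one (sub_neg.2 hα1).ne, sub_add_cancel]
  have h3 : Real.Gamma (α - 1) ≠ 0 := by
    intro h
    rw [h, mul_zero] at h2
    exact (Real.Gamma_pos_of_pos hα).ne' h2
  rw [h1, h2]
  field_simp
  ring

include hα hα1 in
-- The integer powers s^0 and s^1 contribute nothing, being at poles of Γ; only k = l = 1 survives.
lemma andradeLongTimeSum_two (x : ℝ) :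
    andradeLongTimeSum α 2 x = α * (1 - α) * x ^ (α - 2) := by
  have hG1 : Real.Gamma (-1) = 0 := by
    simpa using Real.Gamma_neg_nat_eq_zero 1
  simp only [andradeLongTimeSum, inverseLaplacePower, Finset.sum_range_succ, Finset.sum_range_zero]
  norm_num [hG1]
  rw [← inv_Gamma_sub_one_mul hα hα1, show α - 1 - 1 = α - 2 by ring]
  ring

include hα hα1 in
lemma andradeLongTimeSum_three (x : ℝ) :
    andradeLongTimeSum α 3 x = α * (1 - α) * x ^ (α - 2)
      - 2 * (1 - α) * (Real.Gamma (1 + α) ^ 2 / Real.Gamma (2 * α - 1)) * x ^ (2 * α - 3)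
      + 2 * Real.Gamma (1 + α) * (Real.Gamma (α - 2))⁻¹ * x ^ (α - 3) := by
  have hG2 : Real.Gamma (-2) = 0 := by
    simpa using Real.Gamma_neg_nat_eq_zero 2
  -- This includes α = 1/2, where both inverses are 0; the recursion only needs 2α - 2 ≠ 0.
  have hrec : (Real.Gamma (2 * α - 2))⁻¹ = -(2 * (1 - α)) * (Real.Gamma (2 * α - 1))⁻¹ := by
    have hne : 2 * α - 2 ≠ 0 := by linarith
    have : Real.Gamma (2 * α - 1) = (2 * α - 2) * Real.Gamma (2 * α - 2) := by
      rw [← Real.Gamma_add_one hne]; ring_nf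
    rw [this, mul_inv, ← mul_assoc, show -(2 * (1 - α)) = 2 * α - 2 by ring, mul_inv_cancel₀ hne,
      one_mul]
  have hstep : andradeLongTimeSum α 3 x = andradeLongTimeSum α 2 x +
      (-1 : ℝ) ^ 2 * ∑ l ∈ Finset.range (2 + 1), (Nat.choose 2 l : ℝ) * Real.Gamma (1 + α) ^ l *
        inverseLaplacePower (((2 : ℕ) : ℝ) - (l : ℝ) * α) x := by
    rw [andradeLongTimeSum, Finset.sum_range_succ]; rfl
  rw [hstep, andradeLongTimeSum_two hα hα1]
  simp only [inverseLaplacePower, Finset.sum_range_succ, Finset.sum_range_zero]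
  norm_num [hG2]
  rw [hrec, show α - 2 - 1 = α - 3 by ring, show 2 * α - 2 - 1 = 2 * α - 3 by ring]
  ring

lemma isLittleO_rpow_rpow_atTop {a b : ℝ} (hab : a < b) :
    (fun x : ℝ => x ^ a) =o[atTop] fun x : ℝ => x ^ b := by
  refine (isLittleO_iff_tendsto' ?_).2 ?_
  · filter_upwards [eventually_gt_atTop 0] with x hx h
    exact absurd h (Real.rpow_pos_of_pos hx b).ne'
  · refine (tendsto_rpow_neg_atTop (sub_pos.2 hab)).congr' ?_
    filter_upwards [eventually_gt_atTop 0] with x hx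
    rw [← Real.rpow_sub hx, neg_sub]

include hα hα1 hμ hτ in
lemma IsRelaxationModulus.isBigO_sub {G : ℝ → ℝ}
    (hG : IsRelaxationModulus (andradeCreepCompliance α μ τ) G) (N : ℕ) :
    (fun t : ℝ => G t - μ * andradeLongTimeSum α N (t / τ))
      =O[atTop] fun t : ℝ => (t / τ) ^ (-((N : ℝ) * (1 - α)) - 1) := by
  have h := ((isBigO_spectralLaplace_sub hα hα1 N).comp_tendsto
    (tendsto_id.atTop_div_const hτ)).const_mul_left μ
  refine h.congr' ?_ (Eventually.of_forall fun _ => rfl)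
  filter_upwards [eventually_gt_atTop 0] with t ht
  rw [hG.eqOn (isRelaxationModulus_andradeRelaxationModulus hα hα1 hμ hτ) ht,
    andradeRelaxationModulus]
  exact mul_sub _ _ _

include hα hα1 hμ hτ in
lemma IsRelaxationModulus.isEquivalent {G : ℝ → ℝ}
    (hG : IsRelaxationModulus (andradeCreepCompliance α μ τ) G) :
    G ~[atTop] fun t : ℝ => μ * α * (1 - α) * (t / τ) ^ (α - 2) := by
  -- The error exponent is 2α - 3, which is below α - 2 because α < 1.
  have h := hG.isBigO_sub hα hα1 hμ hτ 2
  have ho : (fun t : ℝ => (t / τ) ^ (-(((2 : ℕ) : ℝ) * (1 - α)) - 1)) =o[atTop]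
      fun t : ℝ => (t / τ) ^ (α - 2) :=
    (isLittleO_rpow_rpow_atTop (by push_cast; linarith)).comp_tendsto
      (tendsto_id.atTop_div_const hτ)
  have hne : μ * α * (1 - α) ≠ 0 := by
    have := sub_pos.2 hα1
    positivity
  refine ((h.trans_isLittleO ho).const_mul_right hne).congr_left fun t => ?_
  rw [andradeLongTimeSum_two hα hα1, Pi.sub_apply]
  ring

include hα hα1 hμ hτ in
lemma IsRelaxationModulus.isLittleO_sub {G : ℝ → ℝ}
    (hG : IsRelaxationModulus (andradeCreepCompliance α μ τ) G) :
    (fun t : ℝ => G t - (μ * α * (1 - α) * (t / τ) ^ (α - 2)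
        - 2 * μ * (1 - α) * (Real.Gamma (1 + α) ^ 2 / Real.Gamma (2 * α - 1))
          * (t / τ) ^ (2 * α - 3)))
      =o[atTop] fun t : ℝ => (t / τ) ^ (2 * α - 3) := by
  have htend : Tendsto (fun t : ℝ => t / τ) atTop atTop := tendsto_id.atTop_div_const hτ
  -- The error for N = 2 has exactly the order of the second term, so N = 3 is needed. Its error
  -- exponent 3α - 4 is below 2α - 3 since α < 1, and the extra term of exponent α - 3 is negligible
  -- since α > 0.
  have h1 := (hG.isBigO_sub hα hα1 hμ hτ 3).trans_isLittleO
    ((isLittleO_rpow_rpow_atTop (a := -(((3 : ℕ) : ℝ) * (1 - α)) - 1) (b := 2 * α - 3)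
      (by push_cast; linarith)).comp_tendsto htend)
  have h2 := ((isLittleO_rpow_rpow_atTop (a := α - 3) (b := 2 * α - 3)
    (by linarith)).comp_tendsto htend).const_mul_left
      (μ * (2 * Real.Gamma (1 + α) * (Real.Gamma (α - 2))⁻¹))
  refine (h1.add h2).congr_left fun t => ?_
  rw [andradeLongTimeSum_three hα hα1, Function.comp_apply]
  ring

end Andrade

theorem mainTheorem3 (μ τ : ℝ) (hμ : 0 < μ) (hτ : 0 < τ) :
    (∀ α : ℝ, 0 < α → α < 1 →
      (∃ G : ℝ → ℝ, IsRelaxationModulus (andradeCreepCompliance α μ τ) G) ∧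
      ∀ G : ℝ → ℝ, IsRelaxationModulus (andradeCreepCompliance α μ τ) G →
        (G ~[atTop] fun t : ℝ => μ * α * (1 - α) * (t / τ) ^ (α - 2)) ∧
        ((fun t : ℝ => G t - (μ * α * (1 - α) * (t / τ) ^ (α - 2)
            - 2 * μ * (1 - α) * (Real.Gamma (1 + α) ^ 2 / Real.Gamma (2 * α - 1))
              * (t / τ) ^ (2 * α - 3)))
          =o[atTop] fun t : ℝ => (t / τ) ^ (2 * α - 3)) ∧
        (∀ N : ℕ, (fun t : ℝ => G t - μ * andradeLongTimeSum α N (t / τ))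
          =O[atTop] fun t : ℝ => (t / τ) ^ (-((N : ℝ) * (1 - α)) - 1))) ∧
    (∀ G : ℝ → ℝ, IsRelaxationModulus (andradeCreepCompliance (1 / 3) μ τ) G →
      G ~[atTop] fun t : ℝ => 2 / 9 * μ * (t / τ) ^ (-(5 / 3 : ℝ))) := by
  refine ⟨fun α hα hα1 =>
    ⟨⟨_, isRelaxationModulus_andradeRelaxationModulus hα hα1 hμ hτ⟩, fun G hG =>
      ⟨hG.isEquivalent hα hα1 hμ hτ, hG.isLittleO_sub hα hα1 hμ hτ,
        hG.isBigO_sub hα hα1 hμ hτ⟩⟩, fun G hG => ?_⟩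
  have h := hG.isEquivalent (by norm_num) (by norm_num) hμ hτ
  have hfun : (fun t : ℝ => 2 / 9 * μ * (t / τ) ^ (-(5 / 3 : ℝ))) =
      fun t : ℝ => μ * (1 / 3) * (1 - 1 / 3) * (t / τ) ^ ((1 / 3 : ℝ) - 2) := by
    ext t
    rw [show ((1 / 3 : ℝ) - 2) = -(5 / 3) by norm_num]
    ring
  rw [hfun]
  exact h
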